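/- Let $N\ge 1$, $m\ge 0$, $0<\gamma<2s<N$, and let $V:\mathbb R^N\to\mathbb R$ be a measurable function (for instance a smooth one) such that $V(x)\ge c_1>0$ for all $x$ and $V(x)\to\infty$ as $|x|\to\infty$. For $\sigma\ge 0$ let $(-\Delta+m^2)^{\sigma}$ be the operator in $L^2(\mathbb R^N)=L^2(\mathbb R^N;\mathbb C)$ given by $(-\Delta+m^2)^{\sigma}u=\mathcal F^{-1}[(|\xi|^2+m^2)^{\sigma}\mathcal F u]$ on its maximal domain, where $\mathcal F$ is the Fourier transform with kernel $e^{-ix\cdot\xi}$ (suitably normalized). Let $$\Sigma^s=\{v\in L^2(\mathbb R^N):\ (-\Delta+m^2)^{s/2}v\in L^2,\ V^{1/2}v\in L^2\},\qquad \|v\|_{\Sigma^s}=\Big(\|(-\Delta+m^2)^{s/2}v\|_2^2+\|V^{1/2}v\|_2^2\Big)^{1/2}.$$ Then the following hold. (a) The inclusion $\Sigma^s\hookrightarrow L^2(\mathbb R^N)$ is a compact operator. (b) If $\{v_n\}\subset\Sigma^s$ converges weakly in $\Sigma^s$ to $U\in\Sigma^s$, then the integrals $\iint\frac{|v_n(x)|^2|v_n(y)|^2}{|x-y|^{\gamma}}\,dx\,dy$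 (for every $n$) and $\iint\frac{|U(x)|^2|U(y)|^2}{|x-y|^{\gamma}}\,dx\,dy$ are finite, and there is a subsequence $\{v_{n_k}\}$ such that, as $k\to\infty$, $$\|v_{n_k}\|_2^2\to\|U\|_2^2\qquad\text{and}\qquad \iint\frac{|v_{n_k}(x)|^2|v_{n_k}(y)|^2}{|x-y|^{\gamma}}\,dx\,dy\to\iint\frac{|U(x)|^2|U(y)|^2}{|x-y|^{\gamma}}\,dx\,dy .$$ -/

import Mathlib

open MeasureTheory Filter Topology
open scoped FourierTransform ENNReal

noncomputable section

/-- The complex Hilbert space `L²(ℝᴺ)` (Lebesgue measure, Euclidean norm on `ℝᴺ`). -/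
abbrev L2Space (N : ℕ) : Type :=
  Lp ℂ 2 (volume : Measure (EuclideanSpace ℝ (Fin N)))

/-- The subspace `{f ∈ L² : a f ∈ L²}` of `L²(ℝᴺ)`. -/
def mulDomain {N : ℕ} (a : EuclideanSpace ℝ (Fin N) → ℝ) : Submodule ℂ (L2Space N) where
  carrier := {f | MemLp (fun x => (a x : ℂ) * f x) 2 volume}
  zero_mem' := by
    refine (memLp_congr_ae ?_).2 (MemLp.zero (ε := ℂ))
    filter_upwards [Lp.coeFn_zero ℂ 2 (volume : Measure (EuclideanSpace ℝ (Fin N)))] with x hx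
    simp
  add_mem' := by
    intro f g hf hg
    refine (memLp_congr_ae ?_).2 (MemLp.add hf hg)
    filter_upwards [Lp.coeFn_add f g] with x hx
    rw [hx]
    exact mul_add _ _ _
  smul_mem' := by
    intro c f hf
    refine (memLp_congr_ae ?_).2 (MemLp.const_smul hf c)
    filter_upwards [Lp.coeFn_smul c f] with x hx
    rw [hx]
    exact mul_left_comm _ _ _

/-- The product `a f` as an element of `L²(ℝᴺ)`, for `f` with `a f ∈ L²`. -/
def mulFun {N : ℕ} (a : EuclideanSpace ℝ (Fin N) → ℝ) (f : mulDomain a) : L2Space N :=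
  MemLp.toLp (fun x => (a x : ℂ) * (f : L2Space N) x) f.2

theorem coeFn_mulFun {N : ℕ} (a : EuclideanSpace ℝ (Fin N) → ℝ) (f : mulDomain a) :
    (mulFun a f : EuclideanSpace ℝ (Fin N) → ℂ) =ᵐ[volume]
      fun x => (a x : ℂ) * (f : L2Space N) x :=
  MemLp.coeFn_toLp _

/-- Multiplication by the real function `a` as an (in general unbounded) operator in `L²(ℝᴺ)`,
with its maximal domain `{f ∈ L² : a f ∈ L²}`. -/
def mulOp {N : ℕ} (a : EuclideanSpace ℝ (Fin N) → ℝ) : L2Space N →ₗ.[ℂ] L2Space N where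
  domain := mulDomain a
  toFun :=
    { toFun := mulFun a
      map_add' := by
        intro f g
        apply Lp.ext
        filter_upwards [coeFn_mulFun a (f + g), coeFn_mulFun a f, coeFn_mulFun a g,
          Lp.coeFn_add (f : L2Space N) (g : L2Space N),
          Lp.coeFn_add (mulFun a f) (mulFun a g)] with x h1 h2 h3 h4 h5
        rw [h1, h5, Pi.add_apply, h2, h3, Submodule.coe_add, h4, Pi.add_apply, mul_add]
      map_smul' := by
        intro c f
        apply Lp.ext
        filter_upwards [coeFn_mulFun a (c • f), coeFn_mulFun a f,
          Lp.coeFn_smul c (f : L2Space N), Lp.coeFn_smul c (mulFun a f)] with x h1 h2 h3 h4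
        rw [RingHom.id_apply, h1, h4, Pi.smul_apply, h2, Submodule.coe_smul, h3, Pi.smul_apply,
          smul_eq_mul, smul_eq_mul, mul_left_comm] }

/-- The symbol of `(-Δ + m²)^σ`. Mathlib's Fourier transform has the kernel `exp(-2πi⟨x, ξ⟩)`,
for which the symbol of `-Δ` is `(2π|ξ|)²`. -/
def besselSymbol {N : ℕ} (m σ : ℝ) (ξ : EuclideanSpace ℝ (Fin N)) : ℝ :=
  ((2 * Real.pi * ‖ξ‖) ^ 2 + m ^ 2) ^ σ

/-- The operator `(-Δ + m²)^σ = 𝓕⁻¹ ∘ (symbol) ∘ 𝓕` in `L²(ℝᴺ)`, on its maximal domain. -/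
def fracOp (N : ℕ) (m σ : ℝ) : L2Space N →ₗ.[ℂ] L2Space N where
  domain := (mulOp (N := N) (besselSymbol m σ)).domain.comap
    (Lp.fourierTransformₗᵢ (EuclideanSpace ℝ (Fin N)) ℂ).toLinearEquiv.toLinearMap
  toFun :=
    (Lp.fourierTransformₗᵢ (EuclideanSpace ℝ (Fin N)) ℂ).symm.toLinearEquiv.toLinearMap ∘ₗ
      (mulOp (N := N) (besselSymbol m σ)).toFun ∘ₗ
        (Lp.fourierTransformₗᵢ (EuclideanSpace ℝ (Fin N)) ℂ).toLinearEquiv.toLinearMap.restrict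
          (fun _ hf => hf)

/-- The functions `v ∈ L²(ℝᴺ)` with `(-Δ + m²)^{s/2} v ∈ L²` and `V^{1/2} v ∈ L²`. -/
def energySubmodule (N : ℕ) (m s : ℝ) (V : EuclideanSpace ℝ (Fin N) → ℝ) :
    Submodule ℂ (L2Space N) :=
  (fracOp N m (s / 2)).domain ⊓ (mulOp (fun x => √(V x))).domain

/-- The energy space `Σˢ`. This is a copy of `energySubmodule` as a vector space; it carries
the energy norm below, not the norm of `L²`. -/
def EnergySpace (N : ℕ) (m s : ℝ) (V : EuclideanSpace ℝ (Fin N) → ℝ) : Type :=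
  energySubmodule N m s V

namespace EnergySpace

variable {N : ℕ} {m s : ℝ} {V : EuclideanSpace ℝ (Fin N) → ℝ}

instance : AddCommGroup (EnergySpace N m s V) :=
  inferInstanceAs (AddCommGroup (energySubmodule N m s V))

instance : Module ℂ (EnergySpace N m s V) :=
  inferInstanceAs (Module ℂ (energySubmodule N m s V))

/-- The inclusion `Σˢ ⊆ L²`. -/
def toL2 : EnergySpace N m s V →ₗ[ℂ] L2Space N :=
  (energySubmodule N m s V).subtype

/-- `v ↦ ((-Δ + m²)^{s/2} v, V^{1/2} v)`, with values in the Hilbert sum `L² ⊕ L²`. -/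
def graphMap : EnergySpace N m s V →ₗ[ℂ] WithLp 2 (L2Space N × L2Space N) :=
  (WithLp.linearEquiv 2 ℂ (L2Space N × L2Space N)).symm.toLinearMap ∘ₗ
    LinearMap.prod
      ((fracOp N m (s / 2)).toFun ∘ₗ Submodule.inclusion inf_le_left)
      ((mulOp (fun x => √(V x))).toFun ∘ₗ Submodule.inclusion inf_le_right)

/-- The energy norm `‖v‖ = (‖(-Δ + m²)^{s/2} v‖₂² + ‖V^{1/2} v‖₂²)^{1/2}`. For arbitrary `V`
this is a seminorm; it is a norm as soon as `V > 0`. -/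
instance : SeminormedAddCommGroup (EnergySpace N m s V) :=
  SeminormedAddCommGroup.induced _ _ (graphMap (N := N) (m := m) (s := s) (V := V))

instance : NormedSpace ℂ (EnergySpace N m s V) :=
  NormedSpace.induced ℂ _ _ (graphMap (N := N) (m := m) (s := s) (V := V))

/-- Weak convergence in `Σˢ`: convergence in the weak topology `σ(Σˢ, (Σˢ)*)`. -/
def TendstoWeakly (v : ℕ → EnergySpace N m s V) (U : EnergySpace N m s V) : Prop :=
  Tendsto (fun n => toWeakSpace ℂ (EnergySpace N m s V) (v n)) atTop
    (𝓝 (toWeakSpace ℂ (EnergySpace N m s V) U))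

end EnergySpace

/-- The Hartree term `∬ |v(x)|² |v(y)|² / |x - y|^γ dx dy` in `[0, ∞]`. -/
def hartree {N : ℕ} (γ : ℝ) (v : L2Space N) : ℝ≥0∞ :=
  ∫⁻ x, ∫⁻ y, ENNReal.ofReal (‖v x‖ ^ 2 * ‖v y‖ ^ 2 / ‖x - y‖ ^ γ)

end

/-!
Compactness of the energy space. For `v` in the unit ball of `Σˢ`, the growth of `V` makes `v`
uniformly small in `L²` outside a large ball `|x| < R`, and the weight `(|ξ|² + m²)^{s/2}` makes
`𝓕 v` uniformly small outside a large ball `|ξ| < ρ`. So the inclusion into `L²` is a limit in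
operator norm of the operators `1_{|x| < R} 𝓕⁻¹ 1_{|ξ| < ρ} 𝓕`. These are Hilbert–Schmidt operators,
hence compact (`isCompactOperator_cutOff_fourierInv_cutOff`).

The Hartree energy. The potential `∫ |v(y)|² |x - y|^{-γ} dy` is bounded, uniformly in `x` and for
`v` in bounded subsets of `Σˢ`; this is a Hardy inequality below the critical exponent `2s`. It
follows from the Morrey-type bound `∫_{B(z, r)} |v|² ≤ C r^{2s}`
(`exists_setLIntegral_closedBall_le`), summed over dyadic balls. For the latter, `v` is split at
frequency `1/r`: by Cauchy–Schwarz, since `|ξ|^{-2s}` is locally integrable for `2s < N`, the low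
frequencies are bounded by a multiple of `r^{-(N - 2s)/2}`, and the high frequencies have `L²` norm
at most `r^s`. With bounded potentials the Hartree energy is continuous for the `L²` distance
(`hartree_le_add`), because `|u|² - |w|²` is small in `L¹` when `u - w` is small in `L²`.

A weakly convergent sequence in `Σˢ` is bounded, so by compactness a subsequence converges in `L²`,
necessarily to the weak limit, and both limits of the theorem follow.
-/

open Metric Module

/-! ### The inverse Fourier transform on `L¹ ∩ L²` -/

section Fourier

variable {E : Type*} [NormedAddCommGroup E] [InnerProductSpace ℝ E] [FiniteDimensional ℝ E]
  [MeasurableSpace E] [BorelSpace E]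

theorem norm_fourierInv_le_integral (f : E → ℂ) (x : E) : ‖𝓕⁻ f x‖ ≤ ∫ ξ, ‖f ξ‖ := by
  rw [Real.fourierInv_eq]
  refine (norm_integral_le_integral_norm _).trans_eq ?_
  simp

theorem continuous_fourierInv_of_integrable {f : E → ℂ} (hf : Integrable f) :
    Continuous (𝓕⁻ f) :=
  VectorFourier.fourierIntegral_continuous (L := -innerₗ E) Real.continuous_fourierChar
    (by simpa using (continuous_inner (𝕜 := ℝ) (E := E)).fun_neg) hf

/-- On `L¹ ∩ L²` the `L²` inverse Fourier transform is given by the Fourier integral. Both sides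
define the same tempered distribution. -/
theorem Lp.fourierInv_ae_eq (f : Lp ℂ 2 (volume : Measure E)) (hf : Integrable f) :
    (𝓕⁻ f : Lp ℂ 2 (volume : Measure E)) =ᵐ[volume] 𝓕⁻ (f : E → ℂ) := by
  have hcont : Continuous (𝓕⁻ (f : E → ℂ)) := continuous_fourierInv_of_integrable hf
  refine ae_eq_of_integral_contDiff_smul_eq
    ((Lp.memLp (𝓕⁻ f : Lp ℂ 2 (volume : Measure E))).locallyIntegrable one_le_two)
    hcont.locallyIntegrable fun g g_smooth g_cpt => ?_
  have hg₁ : HasCompactSupport (Complex.ofRealCLM ∘ g) := g_cpt.comp_left rfl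
  have hg₂ : ContDiff ℝ ((⊤ : ℕ∞) : WithTop ℕ∞) (Complex.ofRealCLM ∘ g) := by fun_prop
  set φ : SchwartzMap E ℂ := hg₁.toSchwartzMap hg₂ with hφ
  have h1 := congrArg (fun T => T φ) (Lp.fourierInv_toTemperedDistribution_eq f)
  simp only [TemperedDistribution.fourierInv_apply, Lp.toTemperedDistribution_apply] at h1
  have h2 : ∫ x, φ x • 𝓕⁻ (f : E → ℂ) x = ∫ x, (𝓕⁻ φ) x • f x := by
    have hinner : Continuous fun p : E × E => (-innerₗ E) p.1 p.2 := by
      simpa using (continuous_inner (𝕜 := ℝ) (E := E)).fun_neg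
    have h := VectorFourier.integral_fourierIntegral_smul_eq_flip (L := -innerₗ E)
      Real.continuous_fourierChar hinner φ.integrable hf (μ := volume) (ν := volume)
    have hflip : (-innerₗ E).flip = -innerₗ E := by
      ext x y
      simp [real_inner_comm]
    rw [hflip] at h
    rw [SchwartzMap.fourierInv_coe]
    exact h.symm
  have h3 := h1.symm.trans h2.symm
  simpa [hφ] using h3

end Fourier

/-! ### Hilbert–Schmidt operators -/

section HilbertSchmidt

variable {α H : Type*} [MeasurableSpace α] {μ : Measure α} [NormedAddCommGroup H]
  [NormedSpace ℂ H]

/-- The operator `v ↦ (x ↦ k x v)` from `H` to `L²(μ)` attached to a square integrable field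
`k` of continuous functionals on `H`. -/
noncomputable def fieldOp (k : Lp (StrongDual ℂ H) 2 μ) : H →L[ℂ] Lp ℂ 2 μ :=
  (ContinuousLinearMap.compLpL₂ 2 μ (NormedSpace.inclusionInDoubleDual ℂ H)).flip k

theorem coeFn_fieldOp (k : Lp (StrongDual ℂ H) 2 μ) (v : H) :
    fieldOp k v =ᵐ[μ] fun x => k x v :=
  ContinuousLinearMap.coeFn_compLp _ k

/-- Such operators are compact: they depend continuously on the field, and those of a field with
finitely many values have finite rank. -/
theorem isCompactOperator_fieldOp (k : Lp (StrongDual ℂ H) 2 μ) :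
    IsCompactOperator (fieldOp k) := by
  induction k using Lp.induction (p := 2) ENNReal.ofNat_ne_top with
  | indicatorConst c hs hμs =>
    rename_i s
    have : fieldOp (Lp.simpleFunc.indicatorConst 2 hs hμs.ne c : Lp (StrongDual ℂ H) 2 μ) =
        (ContinuousLinearMap.toSpanSingleton ℂ (indicatorConstLp 2 hs hμs.ne (1 : ℂ))).comp c := by
      ext1 v
      apply Lp.ext
      filter_upwards [coeFn_fieldOp (Lp.simpleFunc.indicatorConst 2 hs hμs.ne c :
        Lp (StrongDual ℂ H) 2 μ) v, indicatorConstLp_coeFn (p := 2) (hs := hs) (hμs := hμs.ne)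
        (c := c), indicatorConstLp_coeFn (p := 2) (hs := hs) (hμs := hμs.ne) (c := (1 : ℂ)),
        Lp.coeFn_smul (c v) (indicatorConstLp 2 hs hμs.ne (1 : ℂ))] with x h1 h2 h3 h4
      rw [h1, Lp.simpleFunc.coe_indicatorConst, h2]
      simp only [ContinuousLinearMap.comp_apply, ContinuousLinearMap.toSpanSingleton_apply]
      rw [h4, Pi.smul_apply, h3]
      by_cases hx : x ∈ s <;> simp [hx]
    rw [this]
    exact (isCompactOperator_of_locallyCompactSpace_rng
      (ContinuousLinearMap.toSpanSingleton ℂ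
        (indicatorConstLp 2 hs hμs.ne (1 : ℂ)))).comp_clm c
  | add hf hg _ h1 h2 =>
    have : fieldOp (hf.toLp _ + hg.toLp _) = fieldOp (hf.toLp _) + fieldOp (hg.toLp _) :=
      map_add (ContinuousLinearMap.compLpL₂ 2 μ (NormedSpace.inclusionInDoubleDual ℂ H)).flip _ _
    rw [this]
    exact h1.add h2
  | isClosed =>
    exact isClosed_setOfPred_isCompactOperator.preimage
      (ContinuousLinearMap.compLpL₂ 2 μ (NormedSpace.inclusionInDoubleDual ℂ H)).flip.continuous

end HilbertSchmidt

/-! ### Cut-offs in space and in frequency -/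

section CutOff

variable {α : Type*} [MeasurableSpace α] {μ : Measure α}

/-- Multiplication by the indicator function of `A`, as a contraction of `L²`. -/
noncomputable def cutOff (A : Set α) (hA : MeasurableSet A) : Lp ℂ 2 μ →L[ℂ] Lp ℂ 2 μ :=
  LinearMap.mkContinuous
    { toFun := fun f => ((Lp.memLp f).indicator hA).toLp _
      map_add' := fun f g => by
        apply Lp.ext
        filter_upwards [((Lp.memLp f).indicator hA).coeFn_toLp,
          ((Lp.memLp g).indicator hA).coeFn_toLp, ((Lp.memLp (f + g)).indicator hA).coeFn_toLp,
          Lp.coeFn_add f g, Lp.coeFn_add (((Lp.memLp f).indicator hA).toLp _)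
            (((Lp.memLp g).indicator hA).toLp _)] with x h1 h2 h3 h4 h5
        rw [h3, h5, Pi.add_apply, h1, h2]
        by_cases hx : x ∈ A
        · simp only [hx, Set.indicator_of_mem, h4, Pi.add_apply]
        · simp only [hx, not_false_eq_true, Set.indicator_of_notMem, add_zero]
      map_smul' := fun c f => by
        apply Lp.ext
        filter_upwards [((Lp.memLp f).indicator hA).coeFn_toLp,
          ((Lp.memLp (c • f)).indicator hA).coeFn_toLp,
          Lp.coeFn_smul c f, Lp.coeFn_smul c (((Lp.memLp f).indicator hA).toLp _)] with x h1 h2 h3 h4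
        rw [RingHom.id_apply, h2, h4, Pi.smul_apply, h1]
        by_cases hx : x ∈ A <;> simp [hx, h3] } 1 fun f => by
    rw [one_mul]
    refine Lp.norm_le_norm_of_ae_le ?_
    filter_upwards [((Lp.memLp f).indicator hA).coeFn_toLp] with x h1
    simp only [LinearMap.coe_mk, AddHom.coe_mk, h1]
    exact norm_indicator_le_norm_self _ _

theorem coeFn_cutOff (A : Set α) (hA : MeasurableSet A) (f : Lp ℂ 2 μ) :
    cutOff A hA f =ᵐ[μ] A.indicator f :=
  ((Lp.memLp f).indicator hA).coeFn_toLp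

theorem norm_cutOff_le (A : Set α) (hA : MeasurableSet A) (f : Lp ℂ 2 μ) :
    ‖cutOff A hA f‖ ≤ ‖f‖ := by
  simpa using (cutOff A hA).le_of_opNorm_le (LinearMap.mkContinuous_norm_le _ zero_le_one _) f

theorem cutOff_add_cutOff_compl (A : Set α) (hA : MeasurableSet A) (f : Lp ℂ 2 μ) :
    cutOff A hA f + cutOff Aᶜ hA.compl f = f := by
  apply Lp.ext
  filter_upwards [coeFn_cutOff A hA f, coeFn_cutOff Aᶜ hA.compl f,
    Lp.coeFn_add (cutOff A hA f) (cutOff Aᶜ hA.compl f)] with x h1 h2 h3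
  rw [h3, Pi.add_apply, h1, h2, Set.indicator_self_add_compl_apply]

theorem integrable_cutOff (A : Set α) (hA : MeasurableSet A) (hμA : μ A ≠ ∞) (f : Lp ℂ 2 μ) :
    Integrable (cutOff A hA f) μ := by
  refine Integrable.congr ?_ (coeFn_cutOff A hA f).symm
  rw [integrable_indicator_iff hA]
  have : IsFiniteMeasure (μ.restrict A) := ⟨by simpa using hμA.lt_top⟩
  exact ((Lp.memLp f).restrict A).integrable one_le_two

end CutOff

section PlaneWave

variable {E : Type*} [NormedAddCommGroup E] [InnerProductSpace ℝ E]

/-- The plane wave `ξ ↦ exp(-2πi⟨ξ, x⟩)`, truncated to the ball of radius `ρ`. -/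
noncomputable def planeWave (ρ : ℝ) (x : E) : E → ℂ :=
  (ball (0 : E) ρ).indicator
    fun ξ => Complex.exp (((-(2 * Real.pi * inner ℝ ξ x) : ℝ) : ℂ) * Complex.I)

theorem norm_planeWave_sub_le (ρ : ℝ) (x y ξ : E) :
    ‖planeWave ρ x ξ - planeWave ρ y ξ‖ ≤
      (2 * Real.pi * ρ * ‖x - y‖) * ‖(ball (0 : E) ρ).indicator (fun _ => (1 : ℂ)) ξ‖ := by
  by_cases hξ : ξ ∈ ball (0 : E) ρ
  · simp only [planeWave, hξ, Set.indicator_of_mem, norm_one, mul_one]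
    set a : ℝ := -(2 * Real.pi * inner ℝ ξ x)
    set b : ℝ := -(2 * Real.pi * inner ℝ ξ y)
    have hfac : Complex.exp ((a : ℂ) * Complex.I) - Complex.exp ((b : ℂ) * Complex.I) =
        Complex.exp ((b : ℂ) * Complex.I) *
          (Complex.exp (Complex.I * ((a - b : ℝ) : ℂ)) - 1) := by
      rw [mul_sub, ← Complex.exp_add, mul_one]
      congr 2
      push_cast
      ring
    have hab : a - b = -(2 * Real.pi * inner ℝ ξ (x - y)) := by
      simp only [a, b, inner_sub_right]
      ring
    rw [hfac, norm_mul, Complex.norm_exp_ofReal_mul_I, one_mul]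
    refine Real.norm_exp_I_mul_ofReal_sub_one_le.trans ?_
    rw [hab, norm_neg, norm_mul, Real.norm_of_nonneg (by positivity : 0 ≤ 2 * Real.pi)]
    calc 2 * Real.pi * ‖inner ℝ ξ (x - y)‖ ≤ 2 * Real.pi * (‖ξ‖ * ‖x - y‖) := by
          gcongr
          exact norm_inner_le_norm ξ (x - y)
      _ ≤ 2 * Real.pi * (ρ * ‖x - y‖) := by
          gcongr
          exact (mem_ball_zero_iff.1 hξ).le
      _ = 2 * Real.pi * ρ * ‖x - y‖ := by ring
  · simp only [planeWave, hξ, not_false_eq_true, Set.indicator_of_notMem, sub_self, norm_zero,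
      mul_zero, le_refl]

end PlaneWave

section BandLimited

variable {E : Type*} [NormedAddCommGroup E] [InnerProductSpace ℝ E] [FiniteDimensional ℝ E]
  [MeasurableSpace E] [BorelSpace E]

theorem memLp_planeWave (ρ : ℝ) (x : E) : MemLp (planeWave ρ x) 2 volume := by
  have h : MemLp ((ball (0 : E) ρ).indicator fun _ => (1 : ℝ)) 2 volume :=
    memLp_indicator_const 2 measurableSet_ball 1 (Or.inr measure_ball_lt_top.ne)
  refine h.of_le ?_ (Eventually.of_forall fun ξ => ?_)
  · refine AEStronglyMeasurable.indicator ?_ measurableSet_ball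
    exact Continuous.aestronglyMeasurable (by fun_prop)
  · by_cases hξ : ξ ∈ ball (0 : E) ρ
    · simp only [planeWave, hξ, Set.indicator_of_mem, Complex.norm_exp_ofReal_mul_I, norm_one,
        le_refl]
    · simp only [planeWave, hξ, not_false_eq_true, Set.indicator_of_notMem, norm_zero, le_refl]

theorem continuous_planeWave (ρ : ℝ) :
    Continuous fun x : E => (memLp_planeWave ρ x).toLp (planeWave ρ x) := by
  set χ : Lp ℂ 2 (volume : Measure E) :=
    indicatorConstLp 2 measurableSet_ball (measure_ball_lt_top (x := (0 : E)) (r := ρ)).ne 1 with hχ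
  have key : ∀ x y : E, ‖(memLp_planeWave ρ x).toLp (planeWave ρ x) -
      (memLp_planeWave ρ y).toLp (planeWave ρ y)‖ ≤ (2 * Real.pi * ρ * ‖x - y‖) * ‖χ‖ := by
    intro x y
    refine Lp.norm_le_mul_norm_of_ae_le_mul ?_
    filter_upwards [Lp.coeFn_sub ((memLp_planeWave ρ x).toLp (planeWave ρ x))
      ((memLp_planeWave ρ y).toLp (planeWave ρ y)), (memLp_planeWave ρ x).coeFn_toLp,
      (memLp_planeWave ρ y).coeFn_toLp, indicatorConstLp_coeFn (p := 2)
        (hs := measurableSet_ball)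
        (hμs := (measure_ball_lt_top (μ := volume) (x := (0 : E)) (r := ρ)).ne)
        (c := (1 : ℂ))] with ξ h1 h2 h3 h4
    rw [h1, Pi.sub_apply, h2, h3, hχ, h4]
    exact norm_planeWave_sub_le ρ x y ξ
  refine continuous_iff_continuousAt.2 fun y => ?_
  rw [ContinuousAt, tendsto_iff_norm_sub_tendsto_zero]
  refine squeeze_zero (fun _ => norm_nonneg _) (fun x => key x y) ?_
  have : Continuous fun x : E => (2 * Real.pi * ρ * ‖x - y‖) * ‖χ‖ := by fun_prop
  simpa using this.tendsto y

/-- The functional `f ↦ ∫_{|ξ| < ρ} exp(2πi⟨ξ, x⟩) f(ξ) dξ` on `L²`. -/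
noncomputable def evalBandLimited (ρ : ℝ) (x : E) :
    StrongDual ℂ (Lp ℂ 2 (volume : Measure E)) :=
  innerSL ℂ ((memLp_planeWave ρ x).toLp (planeWave ρ x))

theorem evalBandLimited_apply (ρ : ℝ) (x : E) (f : Lp ℂ 2 (volume : Measure E)) :
    evalBandLimited ρ x f =
      𝓕⁻ (cutOff (ball (0 : E) ρ) measurableSet_ball f : E → ℂ) x := by
  rw [evalBandLimited, innerSL_apply_apply, L2.inner_def, Real.fourierInv_eq']
  refine integral_congr_ae ?_
  filter_upwards [(memLp_planeWave ρ x).coeFn_toLp,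
    coeFn_cutOff (ball (0 : E) ρ) measurableSet_ball f] with ξ h1 h2
  rw [h1, h2, planeWave]
  by_cases hξ : ξ ∈ ball (0 : E) ρ
  · simp only [hξ, Set.indicator_of_mem, RCLike.inner_apply, ← Complex.exp_conj, smul_eq_mul]
    rw [mul_comm]
    congr 2
    simp only [Complex.ofReal_neg, map_mul, map_neg, Complex.conj_ofReal, Complex.conj_I,
      neg_mul_neg]
  · simp [hξ]

theorem fourierInv_cutOff_ae_eq (ρ : ℝ) (f : Lp ℂ 2 (volume : Measure E)) :
    (𝓕⁻ (cutOff (ball (0 : E) ρ) measurableSet_ball f) : Lp ℂ 2 (volume : Measure E)) =ᵐ[volume]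
      fun x => evalBandLimited ρ x f := by
  refine (Lp.fourierInv_ae_eq _
    (integrable_cutOff _ measurableSet_ball measure_ball_lt_top.ne f)).trans ?_
  exact Eventually.of_forall fun x => (evalBandLimited_apply ρ x f).symm

theorem memLp_evalBandLimited (R ρ : ℝ) :
    MemLp ((ball (0 : E) R).indicator fun x => evalBandLimited ρ x) 2 volume := by
  have hcont : Continuous fun x : E => evalBandLimited ρ x :=
    (innerSL ℂ).continuous.comp (continuous_planeWave ρ)
  obtain ⟨C, hC⟩ := (isCompact_closedBall (0 : E) R).exists_bound_of_continuousOn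
    hcont.continuousOn
  have h : MemLp ((ball (0 : E) R).indicator fun _ => C) 2 volume :=
    memLp_indicator_const 2 measurableSet_ball C (Or.inr measure_ball_lt_top.ne)
  refine h.of_le (hcont.aestronglyMeasurable.indicator measurableSet_ball)
    (Eventually.of_forall fun x => ?_)
  by_cases hx : x ∈ ball (0 : E) R
  · simp only [hx, Set.indicator_of_mem]
    exact (hC x (ball_subset_closedBall hx)).trans (le_abs_self C)
  · simp only [hx, not_false_eq_true, Set.indicator_of_notMem, norm_zero, le_refl]

/-- Localizing in frequency and then in space is a compact operation on `L²`: it is the operator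
of the square integrable field `x ↦ 1_{|x| < R} evalBandLimited ρ x`. -/
theorem isCompactOperator_cutOff_fourierInv_cutOff (R ρ : ℝ) :
    IsCompactOperator fun f : Lp ℂ 2 (volume : Measure E) =>
      cutOff (ball (0 : E) R) measurableSet_ball
        (𝓕⁻ (cutOff (ball (0 : E) ρ) measurableSet_ball f)) := by
  refine (congrArg IsCompactOperator (funext fun f => ?_)).mpr
    (isCompactOperator_fieldOp ((memLp_evalBandLimited (E := E) R ρ).toLp _))
  apply Lp.ext
  filter_upwards [coeFn_fieldOp ((memLp_evalBandLimited (E := E) R ρ).toLp _) f,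
    (memLp_evalBandLimited (E := E) R ρ).coeFn_toLp, fourierInv_cutOff_ae_eq ρ f,
    coeFn_cutOff (ball (0 : E) R) measurableSet_ball
      (𝓕⁻ (cutOff (ball (0 : E) ρ) measurableSet_ball f))] with x h1 h2 h3 h4
  rw [h1, h2, h4]
  by_cases hx : x ∈ ball (0 : E) R
  · simp only [hx, Set.indicator_of_mem, h3]
  · simp [hx]

end BandLimited

/-! ### Compactness of the energy space in `L²` -/

theorem norm_cutOff_le_of_mul {α : Type*} [MeasurableSpace α] {μ : Measure α} {a : α → ℝ}
    {f g : Lp ℂ 2 μ} (hg : g =ᵐ[μ] fun x => (a x : ℂ) * f x) {A : Set α} (hA : MeasurableSet A)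
    {δ : ℝ} (hδ : 0 < δ) (ha : ∀ x ∈ A, δ ≤ a x) : ‖cutOff A hA f‖ ≤ δ⁻¹ * ‖g‖ := by
  refine Lp.norm_le_mul_norm_of_ae_le_mul ?_
  filter_upwards [coeFn_cutOff A hA f, hg] with x h1 h2
  rw [h1, h2]
  by_cases hx : x ∈ A
  · rw [Set.indicator_of_mem hx, norm_mul, Complex.norm_real, ← div_eq_inv_mul, le_div_iff₀ hδ,
      mul_comm]
    exact mul_le_mul_of_nonneg_right ((ha x hx).trans (le_abs_self _)) (norm_nonneg _)
  · rw [Set.indicator_of_notMem hx, norm_zero]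
    positivity

theorem rpow_norm_le_besselSymbol {N : ℕ} (m : ℝ) {σ : ℝ} (hσ : 0 ≤ σ)
    (ξ : EuclideanSpace ℝ (Fin N)) : ‖ξ‖ ^ (2 * σ) ≤ besselSymbol m σ ξ := by
  rw [besselSymbol, Real.rpow_mul (norm_nonneg _), Real.rpow_two]
  refine Real.rpow_le_rpow (by positivity) ?_ hσ
  have h1 : 1 ≤ 2 * Real.pi := by linarith [Real.pi_gt_three]
  have h2 : ‖ξ‖ ^ 2 ≤ (2 * Real.pi * ‖ξ‖) ^ 2 := by
    gcongr
    exact le_mul_of_one_le_left (norm_nonneg _) h1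
  nlinarith [sq_nonneg m]

namespace EnergySpace

variable {N : ℕ} {m s : ℝ} {V : EuclideanSpace ℝ (Fin N) → ℝ}

theorem norm_eq_norm_graphMap (v : EnergySpace N m s V) : ‖v‖ = ‖graphMap v‖ := rfl

/-- The energy norm controls the weighted `L²` norm of the Fourier transform. -/
theorem exists_besselSymbol_mul_fourier (v : EnergySpace N m s V) :
    ∃ g : L2Space N, ‖g‖ ≤ ‖v‖ ∧ g =ᵐ[volume]
      fun ξ => (besselSymbol m (s / 2) ξ : ℂ) * (𝓕 v.toL2 : L2Space N) ξ := by
  refine ⟨mulFun (besselSymbol m (s / 2)) ⟨𝓕 v.toL2, v.2.1⟩, ?_, coeFn_mulFun _ _⟩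
  have h1 : ‖mulFun (besselSymbol m (s / 2)) ⟨𝓕 v.toL2, v.2.1⟩‖ = ‖(graphMap v).fst‖ :=
    ((Lp.fourierTransformₗᵢ (EuclideanSpace ℝ (Fin N)) ℂ).symm.norm_map _).symm
  rw [h1, norm_eq_norm_graphMap]
  exact WithLp.norm_fst_le _ _

/-- The energy norm controls the norm of `V^{1/2} v`. -/
theorem exists_sqrt_mul (v : EnergySpace N m s V) :
    ∃ g : L2Space N, ‖g‖ ≤ ‖v‖ ∧ g =ᵐ[volume] fun x => (√(V x) : ℂ) * v.toL2 x := by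
  refine ⟨mulFun (fun x => √(V x)) ⟨v.toL2, v.2.2⟩, ?_, coeFn_mulFun _ _⟩
  have h1 : ‖mulFun (fun x => √(V x)) ⟨v.toL2, v.2.2⟩‖ = ‖(graphMap v).snd‖ := rfl
  rw [h1, norm_eq_norm_graphMap]
  exact WithLp.norm_snd_le _ _

theorem norm_cutOff_le_of_le {A : Set (EuclideanSpace ℝ (Fin N))} (hA : MeasurableSet A) {M : ℝ}
    (hM : 0 < M) (hV : ∀ x ∈ A, M ≤ V x) (v : EnergySpace N m s V) :
    ‖cutOff A hA v.toL2‖ ≤ (√M)⁻¹ * ‖v‖ := by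
  obtain ⟨g, hgv, hg⟩ := v.exists_sqrt_mul
  refine (norm_cutOff_le_of_mul hg hA (Real.sqrt_pos.2 hM)
    fun x hx => Real.sqrt_le_sqrt (hV x hx)).trans ?_
  gcongr

theorem norm_cutOff_fourier_le (hs : 0 < s) {ρ : ℝ} (hρ : 0 < ρ) (v : EnergySpace N m s V) :
    ‖cutOff (ball 0 ρ)ᶜ measurableSet_ball.compl (𝓕 v.toL2 : L2Space N)‖ ≤ (ρ ^ s)⁻¹ * ‖v‖ := by
  obtain ⟨g, hgv, hg⟩ := v.exists_besselSymbol_mul_fourier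
  refine (norm_cutOff_le_of_mul hg measurableSet_ball.compl (Real.rpow_pos_of_pos hρ s)
    fun ξ hξ => ?_).trans (by gcongr)
  refine le_trans ?_ (rpow_norm_le_besselSymbol m (by positivity) ξ)
  rw [mul_div_cancel₀ s two_ne_zero]
  exact Real.rpow_le_rpow hρ.le (by simpa using hξ) hs.le

theorem norm_toL2_le {c₁ : ℝ} (hc₁ : 0 < c₁) (hV : ∀ x, c₁ ≤ V x) (v : EnergySpace N m s V) :
    ‖v.toL2‖ ≤ (√c₁)⁻¹ * ‖v‖ := by
  refine le_trans (le_of_eq ?_) (norm_cutOff_le_of_le MeasurableSet.univ hc₁ (fun x _ => hV x) v)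
  congr 1
  apply Lp.ext
  filter_upwards [coeFn_cutOff Set.univ MeasurableSet.univ v.toL2] with x hx
  rw [hx, Set.indicator_univ]

/-- If `V` is bounded below by a positive constant and tends to infinity, then `Σˢ` embeds
compactly in `L²`: the growth of `V` makes elements small away from a large ball, the positive
order makes them small at high frequencies, and what remains is a compact operator. -/
theorem isCompactOperator_toL2 {c₁ : ℝ} (hs : 0 < s) (hc₁ : 0 < c₁) (hV : ∀ x, c₁ ≤ V x)
    (hVlim : Tendsto V (cocompact (EuclideanSpace ℝ (Fin N))) atTop) :
    IsCompactOperator (toL2 : EnergySpace N m s V →ₗ[ℂ] L2Space N) := by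
  set T : EnergySpace N m s V →L[ℂ] L2Space N :=
    toL2.mkContinuous (√c₁)⁻¹ (norm_toL2_le hc₁ hV) with hT
  suffices h : T ∈ closure {f : EnergySpace N m s V →L[ℂ] L2Space N | IsCompactOperator f} from
    isClosed_setOfPred_isCompactOperator.closure_eq.subset h
  rw [Metric.mem_closure_iff]
  intro ε hε
  -- `R` and `ρ` are such that each of the two cut-offs costs at most `δ` in operator norm.
  set δ : ℝ := ε / 4 with hδ
  have hδ0 : 0 < δ := by positivity
  obtain ⟨R, hR⟩ : ∃ R : ℝ, ∀ x ∈ (ball (0 : EuclideanSpace ℝ (Fin N)) R)ᶜ, δ⁻¹ ^ 2 ≤ V x := by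
    have h1 := hVlim.eventually_ge_atTop (δ⁻¹ ^ 2)
    rw [← Metric.cobounded_eq_cocompact, ← comap_norm_atTop, eventually_comap, eventually_atTop] at h1
    obtain ⟨R, hR⟩ := h1
    exact ⟨R, fun x hx => hR ‖x‖ (by simpa using hx) x rfl⟩
  set ρ : ℝ := δ⁻¹ ^ s⁻¹ with hρ
  have hρ0 : 0 < ρ := by positivity
  have hρs : (ρ ^ s)⁻¹ = δ := by
    rw [hρ, ← Real.rpow_mul (by positivity), inv_mul_cancel₀ hs.ne', Real.rpow_one, inv_inv]
  set F := Lp.fourierTransformₗᵢ (EuclideanSpace ℝ (Fin N)) ℂ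
  set S : L2Space N →L[ℂ] L2Space N :=
    (cutOff (ball 0 R) measurableSet_ball).comp
      ((F.symm.toLinearIsometry.toContinuousLinearMap).comp
        (cutOff (ball 0 ρ) measurableSet_ball)) with hS
  have hScomp : IsCompactOperator S := isCompactOperator_cutOff_fourierInv_cutOff R ρ
  refine ⟨S.comp (F.toLinearIsometry.toContinuousLinearMap.comp T), hScomp.comp_clm _, ?_⟩
  rw [dist_eq_norm]
  refine lt_of_le_of_lt (ContinuousLinearMap.opNorm_le_bound _ (M := 2 * δ) (by positivity)
    fun v => ?_) (by linarith)
  have hsplit : (T - S.comp (F.toLinearIsometry.toContinuousLinearMap.comp T)) v =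
      cutOff (ball 0 R)ᶜ measurableSet_ball.compl v.toL2 +
        cutOff (ball 0 R) measurableSet_ball
          (F.symm (cutOff (ball 0 ρ)ᶜ measurableSet_ball.compl (F v.toL2))) := by
    have h1 := cutOff_add_cutOff_compl (ball 0 R) measurableSet_ball v.toL2
    have h2 := cutOff_add_cutOff_compl (ball 0 ρ) measurableSet_ball (F v.toL2)
    have h3 := congrArg (fun f => cutOff (ball 0 R) measurableSet_ball (F.symm f)) h2
    simp only [map_add, LinearIsometryEquiv.symm_apply_apply] at h3
    have h4 : S (F v.toL2) = cutOff (ball 0 R) measurableSet_ball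
      (F.symm (cutOff (ball 0 ρ) measurableSet_ball (F v.toL2))) := rfl
    have h5 : (T - S.comp (F.toLinearIsometry.toContinuousLinearMap.comp T)) v =
      v.toL2 - S (F v.toL2) := rfl
    rw [h5, h4, sub_eq_iff_eq_add, add_assoc, add_comm (cutOff _ _ (F.symm _)), h3, add_comm, h1]
  rw [hsplit, two_mul, add_mul]
  refine (norm_add_le _ _).trans (add_le_add ?_ ?_)
  · refine (norm_cutOff_le_of_le measurableSet_ball.compl (by positivity) hR v).trans_eq ?_
    rw [Real.sqrt_sq (by positivity), inv_inv]
  · refine (norm_cutOff_le _ _ _).trans ?_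
    rw [LinearIsometryEquiv.norm_map]
    exact (norm_cutOff_fourier_le hs hρ0 v).trans_eq (by rw [hρs])

end EnergySpace

/-! ### Local mass bounds and the Riesz potential -/

theorem enorm_sq_eq_lintegral {α : Type*} [MeasurableSpace α] {μ : Measure α} (f : Lp ℂ 2 μ) :
    ‖f‖ₑ ^ 2 = ∫⁻ x, ‖f x‖ₑ ^ 2 ∂μ := by
  have h := eLpNorm_nnreal_pow_eq_lintegral (f := f) (μ := μ) (p := 2) two_ne_zero
  simp only [NNReal.coe_ofNat, ENNReal.coe_ofNat, ENNReal.rpow_ofNat] at h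
  rw [← h, Lp.enorm_def]

/-- The singularity `|t|^{-γ}` is dominated by a sum over dyadic balls. -/
theorem ofReal_inv_rpow_norm_le_tsum {E : Type*} [NormedAddCommGroup E] {γ : ℝ} (hγ : 0 < γ)
    (z y : E) :
    ENNReal.ofReal (‖z - y‖ ^ γ)⁻¹ ≤ 1 + ∑' j : ℕ, ENNReal.ofReal ((2 ^ γ) ^ (j + 1)) *
      (closedBall z ((1 / 2 : ℝ) ^ j)).indicator 1 y := by
  rcases (norm_nonneg (z - y)).eq_or_lt with h0 | h0
  · -- On the diagonal the left-hand side is `0` because of the convention `0⁻¹ = 0`.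
    rw [← h0, Real.zero_rpow hγ.ne', inv_zero, ENNReal.ofReal_zero]
    exact zero_le
  rcases le_total 1 ‖z - y‖ with h1 | h1
  · refine le_add_right ?_
    rw [ENNReal.ofReal_le_one]
    exact inv_le_one_of_one_le₀ (Real.one_le_rpow h1 hγ.le)
  · obtain ⟨j, hj1, hj2⟩ := exists_nat_pow_near_of_lt_one h0 h1 (by norm_num : (0 : ℝ) < 1 / 2)
      (by norm_num)
    refine le_add_left (le_trans ?_ (ENNReal.le_tsum j))
    have hy : y ∈ closedBall z ((1 / 2 : ℝ) ^ j) := by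
      rwa [mem_closedBall, dist_comm, dist_eq_norm]
    rw [Set.indicator_of_mem hy, Pi.one_apply, mul_one]
    refine ENNReal.ofReal_le_ofReal ?_
    have h2 : (2 ^ γ : ℝ) ^ (j + 1) = (((1 / 2 : ℝ) ^ (j + 1)) ^ γ)⁻¹ := by
      rw [← Real.rpow_natCast (1 / 2), ← Real.rpow_mul (by norm_num), one_div,
        Real.inv_rpow (by norm_num), inv_inv, mul_comm, Real.rpow_mul (by norm_num),
        Real.rpow_natCast]
    rw [h2]
    exact inv_anti₀ (by positivity) (Real.rpow_le_rpow (by positivity) hj1.le hγ.le)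

section Morrey

variable {E : Type*} [NormedAddCommGroup E] [InnerProductSpace ℝ E] [FiniteDimensional ℝ E]
  [MeasurableSpace E] [BorelSpace E]

theorem integrableOn_ball_norm_rpow_neg {α : ℝ} (hα : 0 < α) (hαd : α < finrank ℝ E) (ρ : ℝ) :
    IntegrableOn (fun ξ : E => ‖ξ‖ ^ (-α)) (ball 0 ρ) := by
  have hd : 1 ≤ finrank ℝ E := by
    have : (0 : ℝ) < finrank ℝ E := hα.trans hαd
    exact_mod_cast this
  refine integrableOn_ball_of_norm_le_rpow (C := 1) (α := α) hd hαd
    (Eventually.of_forall fun ξ => ?_) (Measurable.aestronglyMeasurable (by fun_prop))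
  rw [one_mul, Real.norm_of_nonneg (by positivity)]

open scoped Pointwise in
theorem setLIntegral_ball_norm_rpow_neg {α : ℝ} (hα : 0 < α) (hαd : α < finrank ℝ E) {ρ : ℝ}
    (hρ : 0 < ρ) : ∫⁻ ξ in ball (0 : E) ρ, ENNReal.ofReal (‖ξ‖ ^ (-α)) =
      ENNReal.ofReal (ρ ^ (finrank ℝ E - α)) *
        ∫⁻ ξ in ball (0 : E) 1, ENNReal.ofReal (‖ξ‖ ^ (-α)) := by
  have hnn : ∀ r : ℝ, 0 ≤ᵐ[volume.restrict (ball (0 : E) r)] fun ξ : E => ‖ξ‖ ^ (-α) :=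
    fun r => Eventually.of_forall fun ξ => by positivity
  rw [← ofReal_integral_eq_lintegral_ofReal (integrableOn_ball_norm_rpow_neg hα hαd ρ) (hnn ρ),
    ← ofReal_integral_eq_lintegral_ofReal (integrableOn_ball_norm_rpow_neg hα hαd 1) (hnn 1),
    ← ENNReal.ofReal_mul (by positivity)]
  congr 1
  have h := Measure.setIntegral_comp_smul_of_pos (volume : Measure E)
    (fun ξ : E => ‖ξ‖ ^ (-α)) (ball 0 1) hρ
  have h1 : ρ • ball (0 : E) 1 = ball 0 ρ := by
    rw [_root_.smul_ball hρ.ne', smul_zero, mul_one, Real.norm_of_nonneg hρ.le]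
  have h2 : ∀ ξ : E, ‖ρ • ξ‖ ^ (-α) = ρ ^ (-α) * ‖ξ‖ ^ (-α) := fun ξ => by
    rw [norm_smul, Real.norm_of_nonneg hρ.le, Real.mul_rpow hρ.le (norm_nonneg _)]
  simp only [h1, h2, integral_const_mul, smul_eq_mul] at h
  rw [eq_inv_mul_iff_mul_eq₀ (by positivity)] at h
  rw [← h, ← mul_assoc, ← Real.rpow_natCast ρ (finrank ℝ E), ← Real.rpow_add hρ, sub_eq_add_neg]

/-- Bernstein-type bound: the part of frequency below `ρ` of a function with `|ξ|ˢ f̂ ∈ L²` is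
bounded. -/
theorem enorm_evalBandLimited_sq_le {s : ℝ} {a : E → ℝ} (ha : ∀ ξ, ‖ξ‖ ^ s ≤ a ξ)
    (hE : 0 < finrank ℝ E) {f g : Lp ℂ 2 (volume : Measure E)}
    (hg : g =ᵐ[volume] fun ξ => (a ξ : ℂ) * f ξ) (ρ : ℝ) (x : E) :
    ‖evalBandLimited ρ x f‖ₑ ^ 2 ≤
      (∫⁻ ξ in ball (0 : E) ρ, ENNReal.ofReal (‖ξ‖ ^ (-(2 * s)))) * ‖g‖ₑ ^ 2 := by
  have : Nontrivial E := Module.nontrivial_of_finrank_pos (R := ℝ) hE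
  have h1 : ‖evalBandLimited ρ x f‖ₑ ≤ ∫⁻ ξ in ball (0 : E) ρ, ‖f ξ‖ₑ := by
    have hint := integrable_cutOff (ball (0 : E) ρ) measurableSet_ball measure_ball_lt_top.ne f
    rw [evalBandLimited_apply]
    have h2 := norm_fourierInv_le_integral
      (cutOff (ball (0 : E) ρ) measurableSet_ball f : E → ℂ) x
    rw [← ofReal_norm]
    refine (ENNReal.ofReal_le_ofReal h2).trans_eq ?_
    rw [ofReal_integral_norm_eq_lintegral_enorm hint, ← lintegral_indicator measurableSet_ball]
    refine lintegral_congr_ae ?_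
    filter_upwards [coeFn_cutOff (ball (0 : E) ρ) measurableSet_ball f] with ξ hξ
    rw [hξ, enorm_indicator_eq_indicator_enorm]
  have h2 : ∫⁻ ξ in ball (0 : E) ρ, ‖f ξ‖ₑ ≤
      ∫⁻ ξ in ball (0 : E) ρ,
        ((fun ξ => ENNReal.ofReal (‖ξ‖ ^ (-s))) * (fun ξ => ‖g ξ‖ₑ) : E → ℝ≥0∞) ξ := by
    refine lintegral_mono_ae (ae_restrict_of_ae ?_)
    filter_upwards [hg, Measure.ae_ne volume (0 : E)] with ξ h3 h4
    have h5 : 0 < ‖ξ‖ ^ s := Real.rpow_pos_of_pos (norm_pos_iff.2 h4) s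
    rw [Pi.mul_apply, h3, enorm_mul, ← mul_assoc, ← ofReal_norm (a ξ : ℂ),
      ← ENNReal.ofReal_mul (by positivity), Complex.norm_real, Real.rpow_neg (norm_nonneg _)]
    refine le_mul_of_one_le_left zero_le ?_
    rw [ENNReal.one_le_ofReal, ← div_eq_inv_mul, one_le_div h5]
    exact (ha ξ).trans (le_abs_self _)
  have h3 := ENNReal.lintegral_mul_le_Lp_mul_Lq (volume.restrict (ball (0 : E) ρ))
    Real.HolderConjugate.two_two (f := fun ξ => ENNReal.ofReal (‖ξ‖ ^ (-s)))
    (g := fun ξ => ‖g ξ‖ₑ) (by fun_prop) (Lp.aestronglyMeasurable g).enorm.restrict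
  have h4 := (h1.trans h2).trans h3
  have h5 : ∀ t : ℝ≥0∞, (t ^ (1 / 2 : ℝ)) ^ 2 = t := fun t => by
    rw [← ENNReal.rpow_ofNat, ← ENNReal.rpow_mul]
    norm_num
  refine (pow_le_pow_left' h4 2).trans ?_
  rw [mul_pow, h5, h5, enorm_sq_eq_lintegral]
  simp only [ENNReal.rpow_ofNat]
  refine mul_le_mul' (lintegral_mono fun ξ => ?_) (setLIntegral_le_lintegral _ _)
  rw [← ENNReal.ofReal_pow (by positivity), ← Real.rpow_mul_natCast (norm_nonneg _)]
  exact ENNReal.ofReal_le_ofReal (by norm_num [mul_comm])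

/-- Morrey-type bound: a function with `|ξ|ˢ f̂ ∈ L²` has mass `O(r²ˢ)` in every ball of radius
`r`. It is split at frequency `1/r`: the low part is bounded, the high part is small in `L²`. -/
theorem exists_setLIntegral_closedBall_le {s : ℝ} (hs : 0 < s) (hsd : 2 * s < finrank ℝ E) :
    ∃ C : ℝ≥0∞, C ≠ ∞ ∧ ∀ (a : E → ℝ), (∀ ξ, ‖ξ‖ ^ s ≤ a ξ) →
      ∀ v g : Lp ℂ 2 (volume : Measure E),
        (g =ᵐ[volume] fun ξ => (a ξ : ℂ) * (𝓕 v : Lp ℂ 2 (volume : Measure E)) ξ) →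
        ∀ (z : E) (r : ℝ), 0 < r →
          ∫⁻ y in closedBall z r, ‖v y‖ₑ ^ 2 ≤ C * ENNReal.ofReal (r ^ (2 * s)) * ‖g‖ₑ ^ 2 := by
  have hE : 0 < finrank ℝ E := by
    have : (0 : ℝ) < finrank ℝ E := by linarith
    exact_mod_cast this
  have : Nontrivial E := Module.nontrivial_of_finrank_pos (R := ℝ) hE
  set K : ℝ≥0∞ := ∫⁻ ξ in ball (0 : E) 1, ENNReal.ofReal (‖ξ‖ ^ (-(2 * s))) with hK
  have hKtop : K ≠ ∞ :=
    (integrableOn_ball_norm_rpow_neg (by positivity) hsd 1).lintegral_lt_top.ne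
  refine ⟨2 * (K * volume (closedBall (0 : E) 1) + 1), ?_, ?_⟩
  · have := (measure_closedBall_lt_top (μ := (volume : Measure E)) (x := 0) (r := 1)).ne
    finiteness
  intro a ha v g hg z r hr
  set f : Lp ℂ 2 (volume : Measure E) := 𝓕 v with hf
  set lo : Lp ℂ 2 (volume : Measure E) := 𝓕⁻ (cutOff (ball 0 r⁻¹) measurableSet_ball f) with hlo
  set hi : Lp ℂ 2 (volume : Measure E) :=
    𝓕⁻ (cutOff (ball 0 r⁻¹)ᶜ measurableSet_ball.compl f) with hhi
  -- `hi` is at most `r ^ s * ‖g‖` in `L²`, and `lo` is bounded by the Bernstein-type bound.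
  have hv : lo + hi = v := by
    have h := congrArg (fun u => (Lp.fourierTransformₗᵢ E ℂ).symm u)
      (cutOff_add_cutOff_compl (ball 0 r⁻¹) measurableSet_ball f)
    simp only [map_add] at h
    exact h.trans ((Lp.fourierTransformₗᵢ E ℂ).symm_apply_apply v)
  have hhi_le : ‖hi‖ₑ ^ 2 ≤ ENNReal.ofReal (r ^ (2 * s)) * ‖g‖ₑ ^ 2 := by
    have h1 : ‖hi‖ ≤ r ^ s * ‖g‖ := by
      rw [hhi]
      refine ((Lp.fourierTransformₗᵢ E ℂ).symm.norm_map _).le.trans ?_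
      have h2 := norm_cutOff_le_of_mul hg (A := (ball (0 : E) r⁻¹)ᶜ) measurableSet_ball.compl
        (δ := r⁻¹ ^ s) (by positivity) fun ξ hξ =>
          (Real.rpow_le_rpow (by positivity) (by simpa using hξ) hs.le).trans (ha ξ)
      rwa [Real.inv_rpow hr.le, inv_inv] at h2
    rw [← ofReal_norm, ← ofReal_norm, ← ENNReal.ofReal_pow (norm_nonneg _),
      ← ENNReal.ofReal_pow (norm_nonneg _), ← ENNReal.ofReal_mul (by positivity)]
    refine ENNReal.ofReal_le_ofReal ((pow_le_pow_left₀ (norm_nonneg _) h1 2).trans_eq ?_)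
    rw [mul_pow, ← Real.rpow_mul_natCast hr.le]
    norm_num [mul_comm]
  have hlo_le : ∀ᵐ y, ‖lo y‖ₑ ^ 2 ≤
      ENNReal.ofReal (r⁻¹ ^ (finrank ℝ E - 2 * s)) * K * ‖g‖ₑ ^ 2 := by
    filter_upwards [fourierInv_cutOff_ae_eq r⁻¹ f] with y hy
    rw [hlo, hy, hK, ← setLIntegral_ball_norm_rpow_neg (by positivity) hsd (by positivity)]
    exact enorm_evalBandLimited_sq_le ha hE hg r⁻¹ y
  have hpt : ∀ᵐ y, ‖v y‖ₑ ^ 2 ≤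
      2 * (ENNReal.ofReal (r⁻¹ ^ (finrank ℝ E - 2 * s)) * K * ‖g‖ₑ ^ 2 + ‖hi y‖ₑ ^ 2) := by
    filter_upwards [hlo_le, Lp.coeFn_add lo hi] with y h1 h2
    rw [← hv, h2, Pi.add_apply]
    refine (pow_le_pow_left' (enorm_add_le _ _) 2).trans ?_
    have h3 := ENNReal.rpow_add_le_mul_rpow_add_rpow ‖lo y‖ₑ ‖hi y‖ₑ one_le_two
    norm_num at h3
    refine h3.trans ?_
    gcongr
  have hvol : volume (closedBall z r) =
      ENNReal.ofReal (r ^ finrank ℝ E) * volume (closedBall (0 : E) 1) :=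
    Measure.addHaar_closedBall' volume z hr.le
  have hr2 : ENNReal.ofReal (r⁻¹ ^ (finrank ℝ E - 2 * s)) * ENNReal.ofReal (r ^ finrank ℝ E) =
      ENNReal.ofReal (r ^ (2 * s)) := by
    rw [← ENNReal.ofReal_mul (by positivity), Real.inv_rpow hr.le, ← Real.rpow_neg hr.le,
      ← Real.rpow_natCast r, ← Real.rpow_add hr]
    ring_nf
  calc ∫⁻ y in closedBall z r, ‖v y‖ₑ ^ 2
      ≤ ∫⁻ y in closedBall z r,
          2 * (ENNReal.ofReal (r⁻¹ ^ (finrank ℝ E - 2 * s)) * K * ‖g‖ₑ ^ 2 + ‖hi y‖ₑ ^ 2) :=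
        lintegral_mono_ae (ae_restrict_of_ae hpt)
    _ = 2 * (ENNReal.ofReal (r⁻¹ ^ (finrank ℝ E - 2 * s)) * K * ‖g‖ₑ ^ 2 *
          volume (closedBall z r) + ∫⁻ y in closedBall z r, ‖hi y‖ₑ ^ 2) := by
        rw [lintegral_const_mul' _ _ (by simp), lintegral_add_left measurable_const,
          setLIntegral_const]
    _ ≤ 2 * (ENNReal.ofReal (r⁻¹ ^ (finrank ℝ E - 2 * s)) * K * ‖g‖ₑ ^ 2 *
          volume (closedBall z r) + ENNReal.ofReal (r ^ (2 * s)) * ‖g‖ₑ ^ 2) := by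
        gcongr
        refine (setLIntegral_le_lintegral _ _).trans ?_
        rwa [← enorm_sq_eq_lintegral]
    _ = 2 * ((ENNReal.ofReal (r⁻¹ ^ (finrank ℝ E - 2 * s)) * ENNReal.ofReal (r ^ finrank ℝ E)) *
          (K * volume (closedBall (0 : E) 1)) * ‖g‖ₑ ^ 2 +
            ENNReal.ofReal (r ^ (2 * s)) * ‖g‖ₑ ^ 2) := by
        rw [hvol]
        ring
    _ = 2 * (K * volume (closedBall (0 : E) 1) + 1) * ENNReal.ofReal (r ^ (2 * s)) *
          ‖g‖ₑ ^ 2 := by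
        rw [hr2]
        ring

/-- The potential `|v|² * |·|^{-γ}` is bounded, uniformly on bounded sets of the energy space:
this is the Hardy inequality with a subcritical exponent. -/
theorem exists_lintegral_mul_inv_rpow_le {s γ : ℝ} (hγ : 0 < γ) (hγs : γ < 2 * s)
    (hsd : 2 * s < finrank ℝ E) :
    ∃ C : ℝ≥0∞, C ≠ ∞ ∧ ∀ (a : E → ℝ), (∀ ξ, ‖ξ‖ ^ s ≤ a ξ) →
      ∀ v g : Lp ℂ 2 (volume : Measure E),
        (g =ᵐ[volume] fun ξ => (a ξ : ℂ) * (𝓕 v : Lp ℂ 2 (volume : Measure E)) ξ) →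
        ∀ z : E, ∫⁻ y, ‖v y‖ₑ ^ 2 * ENNReal.ofReal (‖z - y‖ ^ γ)⁻¹ ≤
          ‖v‖ₑ ^ 2 + C * ‖g‖ₑ ^ 2 := by
  have hs : 0 < s := by linarith
  obtain ⟨C, hC, hmorrey⟩ := exists_setLIntegral_closedBall_le (E := E) hs hsd
  set q : ℝ := 2 ^ (γ - 2 * s) with hq
  have hq1 : q < 1 := Real.rpow_lt_one_of_one_lt_of_neg (by norm_num) (by linarith)
  refine ⟨ENNReal.ofReal (2 ^ γ) * C * (1 - ENNReal.ofReal q)⁻¹, ?_, ?_⟩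
  · have : (1 - ENNReal.ofReal q)⁻¹ ≠ ∞ := by
      rw [ENNReal.inv_ne_top, Ne, tsub_eq_zero_iff_le, not_le, ENNReal.ofReal_lt_one]
      exact hq1
    finiteness
  intro a ha v g hg z
  have hvm : AEMeasurable (fun y => ‖v y‖ₑ ^ 2) volume :=
    (Lp.aestronglyMeasurable v).enorm.pow_const 2
  have hterm : ∀ j : ℕ, ∫⁻ y, ‖v y‖ₑ ^ 2 * (ENNReal.ofReal ((2 ^ γ) ^ (j + 1)) *
      (closedBall z ((1 / 2 : ℝ) ^ j)).indicator 1 y) ≤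
      ENNReal.ofReal (2 ^ γ) * C * ‖g‖ₑ ^ 2 * ENNReal.ofReal q ^ j := by
    intro j
    have h1 : ∀ y, ‖v y‖ₑ ^ 2 * (ENNReal.ofReal ((2 ^ γ) ^ (j + 1)) *
        (closedBall z ((1 / 2 : ℝ) ^ j)).indicator 1 y) = ENNReal.ofReal ((2 ^ γ) ^ (j + 1)) *
          (closedBall z ((1 / 2 : ℝ) ^ j)).indicator (fun y => ‖v y‖ₑ ^ 2) y := by
      intro y
      by_cases hy : y ∈ closedBall z ((1 / 2 : ℝ) ^ j)
      · simp only [Set.indicator_of_mem hy, Pi.one_apply, mul_one]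
        exact mul_comm _ _
      · simp only [Set.indicator_of_notMem hy, mul_zero]
    simp only [h1]
    rw [lintegral_const_mul' _ _ ENNReal.ofReal_ne_top, lintegral_indicator measurableSet_closedBall]
    refine (mul_le_mul_right (hmorrey a ha v g hg z _ (by positivity)) _).trans_eq ?_
    have h2 : ENNReal.ofReal ((2 ^ γ) ^ (j + 1)) * ENNReal.ofReal (((1 / 2 : ℝ) ^ j) ^ (2 * s)) =
        ENNReal.ofReal (2 ^ γ) * ENNReal.ofReal q ^ j := by
      rw [← ENNReal.ofReal_pow (by positivity), ← ENNReal.ofReal_mul (by positivity),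
        ← ENNReal.ofReal_mul (by positivity)]
      congr 1
      rw [pow_succ', mul_assoc]
      congr 1
      rw [← Real.rpow_natCast (1 / 2), ← Real.rpow_mul (by norm_num), mul_comm (j : ℝ),
        Real.rpow_mul (by norm_num), Real.rpow_natCast, ← mul_pow]
      congr 1
      rw [hq, sub_eq_add_neg, Real.rpow_add (by norm_num), one_div, Real.inv_rpow (by norm_num),
        ← Real.rpow_neg (by norm_num)]
    calc _ = (ENNReal.ofReal ((2 ^ γ) ^ (j + 1)) *
          ENNReal.ofReal (((1 / 2 : ℝ) ^ j) ^ (2 * s))) * (C * ‖g‖ₑ ^ 2) := by ring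
      _ = _ := by rw [h2]; ring
  calc ∫⁻ y, ‖v y‖ₑ ^ 2 * ENNReal.ofReal (‖z - y‖ ^ γ)⁻¹
      ≤ ∫⁻ y, (‖v y‖ₑ ^ 2 + ∑' j : ℕ, ‖v y‖ₑ ^ 2 * (ENNReal.ofReal ((2 ^ γ) ^ (j + 1)) *
          (closedBall z ((1 / 2 : ℝ) ^ j)).indicator 1 y)) := by
        refine lintegral_mono fun y => ?_
        rw [ENNReal.tsum_mul_left, ← mul_one_add]
        exact mul_le_mul_right (ofReal_inv_rpow_norm_le_tsum hγ z y) _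
    _ = ‖v‖ₑ ^ 2 + ∑' j : ℕ, ∫⁻ y, ‖v y‖ₑ ^ 2 * (ENNReal.ofReal ((2 ^ γ) ^ (j + 1)) *
          (closedBall z ((1 / 2 : ℝ) ^ j)).indicator 1 y) := by
        rw [lintegral_add_left' hvm, enorm_sq_eq_lintegral, lintegral_tsum]
        exact fun j => hvm.mul (((measurable_one.indicator
          measurableSet_closedBall).const_mul _).aemeasurable)
    _ ≤ ‖v‖ₑ ^ 2 + ∑' j : ℕ, ENNReal.ofReal (2 ^ γ) * C * ‖g‖ₑ ^ 2 * ENNReal.ofReal q ^ j := by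
        gcongr with j
        exact hterm j
    _ = ‖v‖ₑ ^ 2 + ENNReal.ofReal (2 ^ γ) * C * (1 - ENNReal.ofReal q)⁻¹ * ‖g‖ₑ ^ 2 := by
        rw [ENNReal.tsum_mul_left, ENNReal.tsum_geometric]
        ring

end Morrey

/-! ### The Hartree energy -/

section RieszEnergy

variable {E : Type*} [NormedAddCommGroup E] [InnerProductSpace ℝ E] [FiniteDimensional ℝ E]
  [MeasurableSpace E] [BorelSpace E]

/-- The bilinear energy `∬ f(x) g(y) / |x - y|^γ dx dy` of two densities. -/
noncomputable def rieszEnergy (γ : ℝ) (f g : E → ℝ≥0∞) : ℝ≥0∞ :=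
  ∫⁻ x, f x * ∫⁻ y, g y * ENNReal.ofReal (‖x - y‖ ^ γ)⁻¹

theorem rieszEnergy_comm (γ : ℝ) {f g : E → ℝ≥0∞} (hf : AEMeasurable f) (hg : AEMeasurable g)
    (hf' : ∀ x, f x ≠ ∞) (hg' : ∀ x, g x ≠ ∞) : rieszEnergy γ f g = rieszEnergy γ g f := by
  simp only [rieszEnergy, ← lintegral_const_mul' _ _ (hf' _), ← lintegral_const_mul' _ _ (hg' _)]
  rw [lintegral_lintegral_swap]
  · refine lintegral_congr fun y => lintegral_congr fun x => ?_
    rw [norm_sub_rev x y, mul_left_comm]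
  · exact hf.comp_fst.mul (hg.comp_snd.mul (Measurable.aemeasurable (by fun_prop)))

theorem rieszEnergy_le_add (γ : ℝ) {f f' d g : E → ℝ≥0∞} {P : ℝ≥0∞} (hd : AEMeasurable d)
    (hf : ∀ᵐ x, f x ≤ f' x + d x)
    (hg : ∀ x, ∫⁻ y, g y * ENNReal.ofReal (‖x - y‖ ^ γ)⁻¹ ≤ P) :
    rieszEnergy γ f g ≤ rieszEnergy γ f' g + (∫⁻ x, d x) * P := by
  rw [rieszEnergy, rieszEnergy, ← lintegral_mul_const'' _ hd,
    ← lintegral_add_right' _ (hd.mul_const P)]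
  refine lintegral_mono_ae ?_
  filter_upwards [hf] with x hx
  refine (mul_le_mul_left hx _).trans ?_
  rw [add_mul]
  gcongr
  exact hg x

theorem lintegral_enorm_mul_le {α : Type*} [MeasurableSpace α] {μ : Measure α} (f g : Lp ℂ 2 μ) :
    ∫⁻ x, ‖f x‖ₑ * ‖g x‖ₑ ∂μ ≤ ‖f‖ₑ * ‖g‖ₑ := by
  have h := ENNReal.lintegral_mul_le_Lp_mul_Lq μ Real.HolderConjugate.two_two
    (Lp.aestronglyMeasurable f).enorm (Lp.aestronglyMeasurable g).enorm
  simp only [ENNReal.rpow_ofNat, ← enorm_sq_eq_lintegral] at h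
  have h5 : ∀ t : ℝ≥0∞, (t ^ 2) ^ (1 / 2 : ℝ) = t := fun t => by
    rw [← ENNReal.rpow_ofNat, ← ENNReal.rpow_mul]
    norm_num
  rwa [h5, h5] at h

end RieszEnergy

section Hartree

variable {N : ℕ}

theorem hartree_eq_rieszEnergy (γ : ℝ) (v : L2Space N) :
    hartree γ v = rieszEnergy γ (fun x => ‖v x‖ₑ ^ 2) fun x => ‖v x‖ₑ ^ 2 := by
  rw [hartree, rieszEnergy]
  refine lintegral_congr fun x => ?_
  rw [← lintegral_const_mul' _ _ (by finiteness)]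
  refine lintegral_congr fun y => ?_
  rw [← ofReal_norm, ← ofReal_norm, ← ENNReal.ofReal_pow (norm_nonneg _),
    ← ENNReal.ofReal_pow (norm_nonneg _), ← ENNReal.ofReal_mul (by positivity),
    ← ENNReal.ofReal_mul (by positivity), div_eq_mul_inv, mul_assoc]

theorem hartree_lt_top {γ : ℝ} {v : L2Space N} {P : ℝ≥0∞} (hP : P ≠ ∞)
    (hv : ∀ x, ∫⁻ y, ‖v y‖ₑ ^ 2 * ENNReal.ofReal (‖x - y‖ ^ γ)⁻¹ ≤ P) : hartree γ v < ∞ := by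
  rw [hartree_eq_rieszEnergy, rieszEnergy]
  refine (lintegral_mono fun x => mul_le_mul_right (hv x) _).trans_lt ?_
  rw [lintegral_mul_const' _ _ hP, ← enorm_sq_eq_lintegral]
  finiteness

/-- Among functions whose potentials are bounded by `P`, the Hartree energy is continuous for the
`L²` distance: replace one factor `|u|²` by `|w|²` at a time. -/
theorem hartree_le_add {γ : ℝ} {u w : L2Space N} {P : ℝ≥0∞}
    (hu : ∀ x, ∫⁻ y, ‖u y‖ₑ ^ 2 * ENNReal.ofReal (‖x - y‖ ^ γ)⁻¹ ≤ P)
    (hw : ∀ x, ∫⁻ y, ‖w y‖ₑ ^ 2 * ENNReal.ofReal (‖x - y‖ ^ γ)⁻¹ ≤ P) :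
    hartree γ u ≤ hartree γ w + 2 * (‖u - w‖ₑ * (‖u‖ₑ + ‖w‖ₑ) * P) := by
  have hum := (Lp.aestronglyMeasurable u).enorm
  have hwm := (Lp.aestronglyMeasurable w).enorm
  have huwm := (Lp.aestronglyMeasurable (u - w)).enorm
  set d : EuclideanSpace ℝ (Fin N) → ℝ≥0∞ := fun x => ‖(u - w) x‖ₑ * ‖u x‖ₑ + ‖(u - w) x‖ₑ * ‖w x‖ₑ
    with hd
  have hdm : AEMeasurable d := (huwm.mul hum).add (huwm.mul hwm)
  have hdint : ∫⁻ x, d x ≤ ‖u - w‖ₑ * (‖u‖ₑ + ‖w‖ₑ) := by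
    rw [mul_add]
    refine (lintegral_add_left' (huwm.mul hum) _).trans_le ?_
    exact add_le_add (lintegral_enorm_mul_le _ _) (lintegral_enorm_mul_le _ _)
  have hpt : ∀ᵐ x, ‖u x‖ₑ ^ 2 ≤ ‖w x‖ₑ ^ 2 + d x := by
    filter_upwards [Lp.coeFn_sub u w] with x hx
    have h1 : ‖u x‖ₑ ≤ ‖w x‖ₑ + ‖(u - w) x‖ₑ := by
      rw [hx, Pi.sub_apply]
      calc ‖u x‖ₑ = ‖w x + (u x - w x)‖ₑ := by rw [add_sub_cancel]
        _ ≤ _ := enorm_add_le _ _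
    calc ‖u x‖ₑ ^ 2 = ‖u x‖ₑ * ‖u x‖ₑ := sq _
      _ ≤ (‖w x‖ₑ + ‖(u - w) x‖ₑ) * ‖u x‖ₑ := by gcongr
      _ = ‖w x‖ₑ * ‖u x‖ₑ + ‖(u - w) x‖ₑ * ‖u x‖ₑ := add_mul _ _ _
      _ ≤ ‖w x‖ₑ * (‖w x‖ₑ + ‖(u - w) x‖ₑ) + ‖(u - w) x‖ₑ * ‖u x‖ₑ := by gcongr
      _ = ‖w x‖ₑ ^ 2 + d x := by rw [hd]; ring
  rw [hartree_eq_rieszEnergy, hartree_eq_rieszEnergy]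
  calc _ ≤ rieszEnergy γ (fun x => ‖w x‖ₑ ^ 2) (fun x => ‖u x‖ₑ ^ 2) + (∫⁻ x, d x) * P :=
        rieszEnergy_le_add γ hdm hpt hu
    _ = rieszEnergy γ (fun x => ‖u x‖ₑ ^ 2) (fun x => ‖w x‖ₑ ^ 2) + (∫⁻ x, d x) * P := by
        rw [rieszEnergy_comm γ (hwm.pow_const 2) (hum.pow_const 2)
          (fun x => by finiteness) (fun x => by finiteness)]
    _ ≤ rieszEnergy γ (fun x => ‖w x‖ₑ ^ 2) (fun x => ‖w x‖ₑ ^ 2) + (∫⁻ x, d x) * P +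
          (∫⁻ x, d x) * P := by
        gcongr
        exact rieszEnergy_le_add γ hdm hpt hw
    _ ≤ _ := by
        rw [add_assoc, ← two_mul]
        gcongr

end Hartree

/-! ### Weak convergence in the energy space -/

namespace EnergySpace

variable {N : ℕ} {m s : ℝ} {V : EuclideanSpace ℝ (Fin N) → ℝ}

/-- The graph map as a continuous linear map; it is isometric by the definition of the energy
norm. -/
noncomputable def graphCLM :
    EnergySpace N m s V →L[ℂ] WithLp 2 (L2Space N × L2Space N) :=
  graphMap.mkContinuous 1 fun v => by rw [one_mul, norm_eq_norm_graphMap]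

theorem TendstoWeakly.tendsto_apply {v : ℕ → EnergySpace N m s V} {U : EnergySpace N m s V}
    (h : TendstoWeakly v U) (φ : EnergySpace N m s V →L[ℂ] ℂ) :
    Tendsto (fun n => φ (v n)) atTop (𝓝 (φ U)) :=
  ((WeakBilin.eval_continuous (topDualPairing ℂ (EnergySpace N m s V)).flip φ).tendsto _).comp h

/-- Weakly convergent sequences are bounded, by the uniform boundedness principle in the bidual of
the Hilbert space that contains the graph. -/
theorem TendstoWeakly.exists_norm_le {v : ℕ → EnergySpace N m s V} {U : EnergySpace N m s V}
    (h : TendstoWeakly v U) : ∃ M : ℝ, ∀ n, ‖v n‖ ≤ M := by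
  obtain ⟨M, hM⟩ := banach_steinhaus
    (g := fun n => NormedSpace.inclusionInDoubleDual ℂ (WithLp 2 (L2Space N × L2Space N))
      (graphCLM (v n))) fun φ => by
    obtain ⟨C, hC⟩ := (h.tendsto_apply (φ.comp graphCLM)).norm.bddAbove_range
    exact ⟨C, fun n => hC ⟨n, rfl⟩⟩
  refine ⟨M, fun n => le_trans (le_of_eq ?_) (hM n)⟩
  exact ((NormedSpace.inclusionInDoubleDualLi ℂ).norm_map (graphCLM (v n))).symm

/-- A compact operator turns weak convergence into norm convergence along a subsequence. -/
theorem TendstoWeakly.exists_subseq_tendsto {F : Type*} [NormedAddCommGroup F] [NormedSpace ℂ F]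
    {v : ℕ → EnergySpace N m s V} {U : EnergySpace N m s V} (h : TendstoWeakly v U)
    {T : EnergySpace N m s V →ₗ[ℂ] F} (hT : IsCompactOperator T) :
    ∃ k : ℕ → ℕ, StrictMono k ∧ Tendsto (fun n => T (v (k n))) atTop (𝓝 (T U)) := by
  obtain ⟨M, hM⟩ := h.exists_norm_le
  obtain ⟨K, hK, hTK⟩ := hT.image_closedBall_subset_compact M
  obtain ⟨y, -, k, hk, hy⟩ := hK.tendsto_subseq (x := fun n => T (v n)) fun n =>
    hTK ⟨v n, by simpa using hM n, rfl⟩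
  refine ⟨k, hk, ?_⟩
  suffices y = T U by rwa [← this]
  refine (SeparatingDual.eq_iff_forall_dual_eq (R := ℂ)).2 fun φ => ?_
  have h1 := (φ.continuous.tendsto y).comp hy
  have h2 := (h.tendsto_apply (φ.comp ⟨T, hT.continuous⟩)).comp hk.tendsto_atTop
  exact tendsto_nhds_unique h1 h2

/-- The potential `|v|² * |·|^{-γ}` is bounded in terms of the energy norm. -/
theorem exists_lintegral_mul_inv_rpow_le {γ : ℝ} (hγ : 0 < γ) (hγs : γ < 2 * s)
    (hsN : 2 * s < N) : ∃ C : ℝ≥0∞, C ≠ ∞ ∧ ∀ (v : EnergySpace N m s V)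
      (x : EuclideanSpace ℝ (Fin N)),
        ∫⁻ y, ‖v.toL2 y‖ₑ ^ 2 * ENNReal.ofReal (‖x - y‖ ^ γ)⁻¹ ≤
          ‖v.toL2‖ₑ ^ 2 + C * ‖v‖ₑ ^ 2 := by
  obtain ⟨C, hC, h⟩ := _root_.exists_lintegral_mul_inv_rpow_le
    (E := EuclideanSpace ℝ (Fin N)) hγ hγs (by simpa using hsN)
  refine ⟨C, hC, fun v x => ?_⟩
  obtain ⟨g, hgv, hg⟩ := v.exists_besselSymbol_mul_fourier
  have ha : ∀ ξ : EuclideanSpace ℝ (Fin N), ‖ξ‖ ^ s ≤ besselSymbol m (s / 2) ξ := fun ξ => by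
    simpa [mul_div_cancel₀] using rpow_norm_le_besselSymbol m (σ := s / 2) (by linarith) ξ
  refine (h _ ha v.toL2 g hg x).trans ?_
  gcongr
  exact enorm_le_iff_norm_le.2 hgv

end EnergySpace

theorem lemma3p2 (N : ℕ) (m s γ c₁ : ℝ) (V : EuclideanSpace ℝ (Fin N) → ℝ)
    (hm : 0 ≤ m) (hγ : 0 < γ) (hγs : γ < 2 * s) (hsN : 2 * s < N)
    (hVmeas : Measurable V) (hc₁ : 0 < c₁) (hV : ∀ x, c₁ ≤ V x)
    (hVlim : Tendsto V (cocompact (EuclideanSpace ℝ (Fin N))) atTop) :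
    IsCompactOperator (EnergySpace.toL2 : EnergySpace N m s V →ₗ[ℂ] L2Space N) ∧
    ∀ (v : ℕ → EnergySpace N m s V) (U : EnergySpace N m s V),
      EnergySpace.TendstoWeakly v U →
      ∃ k : ℕ → ℕ, StrictMono k ∧
        Tendsto (fun n => ‖(v (k n)).toL2‖ ^ 2) atTop (𝓝 (‖U.toL2‖ ^ 2)) ∧
        (∀ n, hartree γ (v n).toL2 < ∞) ∧ hartree γ U.toL2 < ∞ ∧
        Tendsto (fun n => hartree γ (v (k n)).toL2) atTop (𝓝 (hartree γ U.toL2)) := by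
  have hcompact : IsCompactOperator (EnergySpace.toL2 : EnergySpace N m s V →ₗ[ℂ] L2Space N) :=
    EnergySpace.isCompactOperator_toL2 (by linarith) hc₁ hV hVlim
  refine ⟨hcompact, fun v U hvU => ?_⟩
  obtain ⟨k, hk, hlim⟩ := hvU.exists_subseq_tendsto hcompact
  obtain ⟨M, hM⟩ := hvU.exists_norm_le
  obtain ⟨C, hC, hpot⟩ := EnergySpace.exists_lintegral_mul_inv_rpow_le (m := m) (V := V) hγ hγs hsN
  -- A common bound for the `L²` norms of `v n` and `U`, and one for their potentials.
  set B : ℝ := max M ‖U‖ with hB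
  set A : ℝ≥0∞ := ENNReal.ofReal ((√c₁)⁻¹ * B) with hA
  set P : ℝ≥0∞ := A ^ 2 + C * ENNReal.ofReal B ^ 2 with hP
  have hPtop : P ≠ ∞ := by finiteness
  have hL2 : ∀ w : EnergySpace N m s V, ‖w‖ ≤ B → ‖w.toL2‖ₑ ≤ A := fun w hw => by
    rw [← ofReal_norm]
    refine ENNReal.ofReal_le_ofReal ((w.norm_toL2_le hc₁ hV).trans ?_)
    gcongr
  have hpotP : ∀ w : EnergySpace N m s V, ‖w‖ ≤ B → ∀ x,
      ∫⁻ y, ‖w.toL2 y‖ₑ ^ 2 * ENNReal.ofReal (‖x - y‖ ^ γ)⁻¹ ≤ P := fun w hw x => by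
    refine (hpot w x).trans ?_
    rw [hP]
    have h1 := hL2 w hw
    have h2 : ‖w‖ₑ ≤ ENNReal.ofReal B := by
      rw [← ofReal_norm]
      exact ENNReal.ofReal_le_ofReal hw
    gcongr
  have hvB : ∀ n, ‖v n‖ ≤ B := fun n => (hM n).trans (le_max_left _ _)
  have hUB : ‖U‖ ≤ B := le_max_right _ _
  have hUfin : hartree γ U.toL2 < ∞ := hartree_lt_top hPtop (hpotP U hUB)
  refine ⟨k, hk, hlim.norm.pow 2, fun n => hartree_lt_top hPtop (hpotP _ (hvB n)), hUfin, ?_⟩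
  set ε : ℕ → ℝ≥0∞ := fun n => 2 * (‖(v (k n)).toL2 - U.toL2‖ₑ * (A + A) * P) with hε
  have hε0 : Tendsto ε atTop (𝓝 0) := by
    have h1 : Tendsto (fun n => ‖(v (k n)).toL2 - U.toL2‖ₑ) atTop (𝓝 0) := by
      simpa using (hlim.sub_const U.toL2).enorm
    have h2 := ENNReal.Tendsto.const_mul (a := 2) (ENNReal.Tendsto.mul_const
      (ENNReal.Tendsto.mul_const h1 (b := A + A) (Or.inr (by finiteness)))
        (b := P) (Or.inr hPtop)) (Or.inr (by simp))
    simpa using h2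
  have hle : ∀ n, hartree γ (v (k n)).toL2 ≤ hartree γ U.toL2 + ε n := fun n => by
    refine (hartree_le_add (hpotP _ (hvB (k n))) (hpotP U hUB)).trans ?_
    have h1 := hL2 _ (hvB (k n))
    have h2 := hL2 U hUB
    simp only [hε]
    gcongr
  have hge : ∀ n, hartree γ U.toL2 - ε n ≤ hartree γ (v (k n)).toL2 := fun n => by
    refine tsub_le_iff_right.2 ((hartree_le_add (hpotP U hUB) (hpotP _ (hvB (k n)))).trans ?_)
    have h1 := hL2 _ (hvB (k n))
    have h2 := hL2 U hUB
    rw [← enorm_neg (U.toL2 - _), neg_sub]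
    simp only [hε]
    gcongr
  refine tendsto_of_tendsto_of_tendsto_of_le_of_le ?_ ?_ hge hle
  · simpa using ENNReal.Tendsto.sub tendsto_const_nhds hε0 (Or.inl hUfin.ne)
  · simpa using tendsto_const_nhds.add hε0
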